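/- **Conventions.** Let $1\le k\le\infty$. All manifolds are real $C^k$ manifolds modelled on a Banach space, Hausdorff, paracompact, non-empty and without boundary. For a chart $(W,\varphi)$ of such a manifold $X$, with model space $(E,|\cdot|)$, and for $x\in W$, $w\in E$, let $v_x(w)=d\varphi^{-1}(\varphi(x))w\in T_xX$ be the tangent vector represented by $w$ in the chart. A *Finsler structure* on $X$ is a continuous function $\|\cdot\|_X:TX\to[0,\infty)$, with restrictions $\|\cdot\|_x$ to $T_xX$, such that 1. for every chart $(W,\varphi)$ and every $x\in W$, $w\mapsto\|v_x(w)\|_x$ is a norm on $E$ equivalent to $|\cdot|$; 2. for every $x_0\in X$ and $c>1$ there is a chart $(W,\varphi)$ at $x_0$ with $c^{-1}\|v_{x_0}(w)\|_{x_0}\le\|v_x(w)\|_x\le c\,\|v_{x_0}(w)\|_{x_0}$ for all $x\in W$, $w\in E$. (Charts here are those of the underlying $C^1$ structure.) A *Finsler manifold* is a manifold with a Finsler structure. The Finsler distance $d_X(x,x')$ is the infimum of the lengths $\int\|\dot\gamma(t)\|_{\gamma(t)}\,dt$ of the $C^1$ paths $\gamma$ joining $x$ to $x'$ (it is $\infty$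 if there is none), and $X$ is *complete* if every $d_X$-Cauchy sequence converges for $d_X$. A $C^k$ map $f:X\to Y$ is a *Fredholm map of index zero* if for every $x\in X$ the operator $df(x):T_xX\to T_{f(x)}Y$ is Fredholm with $\dim\ker df(x)=\dim\operatorname{coker} df(x)$. The indicators of $df(x)$ are, with $y=f(x)$, $$\operatorname{Inj} df(x)=\inf_{\|v\|_x=1}\|df(x)v\|_y,\qquad \operatorname{Sur} df(x)=\inf_{\|v^*\|_y=1}\|df(x)^*v^*\|_x,$$ where in the second formula the norms are the dual norms on $(T_yY)^*$ and $(T_xX)^*$, and $\inf\emptyset=\infty$. We write $\mu(x)\ge\alpha$ if at least one of the two indicators of $df(x)$ is $\ge\alpha$. The map $f$ satisfies the *Earle–Eells condition* if $X$ is complete and for every $y\in Y$ there are $\alpha>0$ and a neighbourhood $V$ of $y$ such that $\mu(x)\ge\alpha$ for all $x\in f^{-1}(V)$. The map $f$ is a *smooth covering map* if it is onto and every $y\in Y$ has an open neighbourhood $V$ such that $f^{-1}(V)$ is the union of a disjoint family of open subsets of $X$, each of which is mapped by $f$ $C^k$-diffeomorphically onto $V$. **Theorem.** Let $X$ and $Y$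 be Finsler manifolds (of class $C^k$, as above) with $Y$ connected, and let $f:X\to Y$ be a $C^k$ Fredholm map of index zero. If $f$ satisfies the Earle–Eells condition, then $f$ is a smooth covering map. -/

import Mathlib

open scoped Manifold ContDiff Topology ENNReal

noncomputable section

/-! ### Norms and Finsler structures

A manifold modelled on a Banach space `E` is a `ChartedSpace E X` with model `𝓘(ℝ, E)`, so it has
no boundary, and its charts take values in open subsets of `E`. -/

/-- `p` is a norm on the vector space `E` that is equivalent to the given norm of `E`
(positivity and definiteness follow from the lower bound). -/
structure IsEquivalentNorm {E : Type*} [NormedAddCommGroup E] [NormedSpace ℝ E]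
    (p : E → ℝ) : Prop where
  add_le : ∀ v w, p (v + w) ≤ p v + p w
  smul_eq : ∀ (c : ℝ) v, p (c • v) = |c| * p v
  exists_lower : ∃ c : ℝ, 0 < c ∧ ∀ v, c * ‖v‖ ≤ p v
  exists_upper : ∃ C : ℝ, 0 < C ∧ ∀ v, p v ≤ C * ‖v‖

section Finsler

variable {E : Type*} [NormedAddCommGroup E] [NormedSpace ℝ E]
  {X : Type*} [TopologicalSpace X] [ChartedSpace E X]

/-- The tangent vector at `x` which is represented by `w : E` in the chart `φ`, namely
`d(φ⁻¹)(φ x) w`, as a point of the tangent bundle.  For `x ∈ φ.source` its base point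
`φ.symm (φ x)` is `x`. -/
def chartVector (φ : OpenPartialHomeomorph X E) (x : X) (w : E) : TangentBundle 𝓘(ℝ, E) X :=
  tangentMap 𝓘(ℝ, E) 𝓘(ℝ, E) φ.symm ⟨φ x, w⟩

variable (E X) in
/-- A Finsler structure in the sense of Palais on a manifold `X` of class at least `C^1`, modelled
on `E`: a continuous function on the tangent bundle which is an admissible norm on each tangent
space and which, for each `k > 1`, is constant up to the factor `k` in a suitable chart at any
given point.  Charts are those of the maximal `C^1` atlas. -/
structure FinslerStructure [IsManifold 𝓘(ℝ, E) 1 X] where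
  toFun : TangentBundle 𝓘(ℝ, E) X → ℝ
  continuous_toFun : Continuous toFun
  admissible : ∀ φ ∈ IsManifold.maximalAtlas 𝓘(ℝ, E) 1 X, ∀ x ∈ φ.source,
    IsEquivalentNorm (fun w : E => toFun (chartVector φ x w))
  locally_almost_constant : ∀ (x₀ : X) (k : ℝ), 1 < k →
    ∃ φ ∈ IsManifold.maximalAtlas 𝓘(ℝ, E) 1 X, x₀ ∈ φ.source ∧
      ∀ x ∈ φ.source, ∀ w : E,
        k⁻¹ * toFun (chartVector φ x₀ w) ≤ toFun (chartVector φ x w) ∧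
        toFun (chartVector φ x w) ≤ k * toFun (chartVector φ x₀ w)

namespace FinslerStructure

variable [IsManifold 𝓘(ℝ, E) 1 X] (N : FinslerStructure E X)

/-- The norm `‖v‖_x` of the tangent vector `v` at `x`. -/
def norm (x : X) (v : TangentSpace 𝓘(ℝ, E) x) : ℝ :=
  N.toFun ⟨x, v⟩

/-- The dual norm of a continuous linear functional on `T_x X`, with respect to `‖·‖_x`. -/
def dualNorm (x : X) (l : TangentSpace 𝓘(ℝ, E) x →L[ℝ] ℝ) : ℝ≥0∞ :=
  ⨆ (v : TangentSpace 𝓘(ℝ, E) x) (_ : N.norm x v ≤ 1), ENNReal.ofReal |l v|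

/-- The Finsler distance: the infimum of the lengths `∫ ‖γ'(t)‖ dt` of the `C^1` paths that join
`x` to `y`.  It is `∞` if there is no such path, i.e. if `x` and `y` lie in different components.
(`Manifold.riemannianEDist` is this infimum for any norm-like function on the tangent spaces.) -/
def edist (x y : X) : ℝ≥0∞ :=
  letI : ∀ z : X, ENorm (TangentSpace 𝓘(ℝ, E) z) := fun z => ⟨fun v => ENNReal.ofReal (N.norm z v)⟩
  Manifold.riemannianEDist 𝓘(ℝ, E) x y

/-- Completeness for the Finsler distance: every Cauchy sequence converges.  If `X` is not
connected this says that every component is complete. -/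
def IsComplete : Prop :=
  ∀ u : ℕ → X, (∀ ε : ℝ≥0∞, 0 < ε → ∃ n₀ : ℕ, ∀ m ≥ n₀, ∀ n ≥ n₀, N.edist (u m) (u n) < ε) →
    ∃ x : X, Filter.Tendsto (fun n => N.edist (u n) x) Filter.atTop (𝓝 0)

end FinslerStructure

end Finsler

section Maps

variable {E : Type*} [NormedAddCommGroup E] [NormedSpace ℝ E]
  {X : Type*} [TopologicalSpace X] [ChartedSpace E X]
  {F : Type*} [NormedAddCommGroup F] [NormedSpace ℝ F]
  {Y : Type*} [TopologicalSpace Y] [ChartedSpace F Y]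

/-! ### Indicators -/

/-- The injectivity indicator `Inj T = inf {‖T v‖_y : ‖v‖_x = 1}` of a continuous linear map
`T : T_x X → T_y Y`, with `inf ∅ = ∞`. -/
def injIndicator [IsManifold 𝓘(ℝ, E) 1 X] [IsManifold 𝓘(ℝ, F) 1 Y]
    (NX : FinslerStructure E X) (NY : FinslerStructure F Y) (x : X) (y : Y)
    (T : TangentSpace 𝓘(ℝ, E) x →L[ℝ] TangentSpace 𝓘(ℝ, F) y) : ℝ≥0∞ :=
  ⨅ (v : TangentSpace 𝓘(ℝ, E) x) (_ : NX.norm x v = 1), ENNReal.ofReal (NY.norm y (T v))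

/-- The surjectivity indicator `Sur T = inf {‖T* l‖_x : ‖l‖_y = 1}` of a continuous linear map
`T : T_x X → T_y Y`, where `l` runs over the dual of `T_y Y`, with `inf ∅ = ∞`. -/
def surIndicator [IsManifold 𝓘(ℝ, E) 1 X] [IsManifold 𝓘(ℝ, F) 1 Y]
    (NX : FinslerStructure E X) (NY : FinslerStructure F Y) (x : X) (y : Y)
    (T : TangentSpace 𝓘(ℝ, E) x →L[ℝ] TangentSpace 𝓘(ℝ, F) y) : ℝ≥0∞ :=
  ⨅ (l : TangentSpace 𝓘(ℝ, F) y →L[ℝ] ℝ) (_ : NY.dualNorm y l = 1), NX.dualNorm x (l.comp T)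

/-- The Earle–Eells condition: `X` is complete, and every `y : Y` has a neighbourhood `V` and a
constant `α > 0` such that `μ(x) ≥ α` for all `x ∈ f⁻¹(V)`, where `μ(x)` stands for any of the two
indicators of `df(x)`. -/
def EarleEellsCondition [IsManifold 𝓘(ℝ, E) 1 X] [IsManifold 𝓘(ℝ, F) 1 Y]
    (NX : FinslerStructure E X) (NY : FinslerStructure F Y) (f : X → Y) : Prop :=
  NX.IsComplete ∧
  ∀ y : Y, ∃ α : ℝ, 0 < α ∧ ∃ V ∈ 𝓝 y, ∀ x ∈ f ⁻¹' V,
    ENNReal.ofReal α ≤ injIndicator NX NY x (f x) (mfderiv 𝓘(ℝ, E) 𝓘(ℝ, F) f x) ∨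
    ENNReal.ofReal α ≤ surIndicator NX NY x (f x) (mfderiv 𝓘(ℝ, E) 𝓘(ℝ, F) f x)

/-! ### Fredholm maps -/

variable (E F) in
/-- `f` is a Fredholm map of class `C^k` and of index zero: each differential `df(x)` is a Fredholm
operator of index `dim Ker df(x) - dim Coker df(x) = 0`. -/
structure IsFredholmMapOfIndexZero (k : ℕ∞) (f : X → Y) : Prop where
  contMDiff : ContMDiff 𝓘(ℝ, E) 𝓘(ℝ, F) k f
  isFredholm : ∀ x, (mfderiv 𝓘(ℝ, E) 𝓘(ℝ, F) f x).IsFredholm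
  index_eq_zero : ∀ x, (mfderiv 𝓘(ℝ, E) 𝓘(ℝ, F) f x).toLinearMap.index = 0

/-! ### Smooth covering maps -/

variable (E F) in
/-- `f` maps the set `U` onto the set `V` diffeomorphically, with respect to `C^k`. -/
def MapsDiffeomorphically (k : ℕ∞) (f : X → Y) (U : Set X) (V : Set Y) : Prop :=
  Set.BijOn f U V ∧ ContMDiffOn 𝓘(ℝ, E) 𝓘(ℝ, F) k f U ∧
  ∃ g : Y → X, Set.MapsTo g V U ∧ Set.InvOn g f U V ∧ ContMDiffOn 𝓘(ℝ, F) 𝓘(ℝ, E) k g V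

variable (E F) in
/-- `f` is a smooth (`C^k`) covering map: it is onto, and each point of `Y` has an open
neighbourhood `V` whose preimage is the union of a disjoint family of open sets, each of which `f`
maps diffeomorphically onto `V`. -/
def IsSmoothCoveringMap (k : ℕ∞) (f : X → Y) : Prop :=
  Function.Surjective f ∧
  ∀ y : Y, ∃ V : Set Y, IsOpen V ∧ y ∈ V ∧
    ∃ 𝒰 : Set (Set X), (∀ U ∈ 𝒰, IsOpen U) ∧ 𝒰.PairwiseDisjoint id ∧ f ⁻¹' V = ⋃₀ 𝒰 ∧
      ∀ U ∈ 𝒰, MapsDiffeomorphically E F k f U V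

end Maps

end

/-!
The theorem is a global inversion theorem of Hadamard type; the covering is obtained by lifting
paths, and completeness of `X` is what makes lifts exist up to the end of the path.

An operator of index zero is bijective as soon as it is injective or surjective.  A positive lower
bound for the injectivity indicator gives injectivity; a positive lower bound for the surjectivity
indicator shows that no nonzero functional vanishes on the (closed) range, hence surjectivity.  By
Hahn–Banach, in both cases the bound `α` for the indicator gives `α ‖v‖ ≤ ‖df(x) v‖`
(`bijective_and_le_map_of_le_indicator`).  So every `df(x)` is an isomorphism, `f` is a local
homeomorphism with `C^k` local inverses
(`exists_openPartialHomeomorph_of_bijective_mfderiv`, `IsLocalHomeomorph.contMDiffOn_lift`), and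
over a neighbourhood of each `y` it expands norms by a uniform factor `α > 0`.

Near `y`, choose a chart in which the norms of `Y` are uniformly equivalent to the norm of the
model space.  A segment in a small ball of that chart has bounded speed `K`, so a partial lift of it
has speed at most `K / α` and is Lipschitz for the Finsler distance of `X`; by completeness it
converges for this distance along a sequence of times tending to the end.  Finsler convergence
implies topological convergence (`FinslerStructure.exists_forall_edist_lt_mem`), so the lift can be
continued by a local inverse (`IsLocalHomeomorph.exists_lift_Icc`,
`exists_lift_of_speedWithin_le`).

Lifting all radii of the ball from a point of the fibre over `y` gives a continuous section of `f`
over the ball; uniqueness of lifts shows that different points of the fibre give disjoint sections,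
and lifting radii inwards shows that every point over the ball lies on one of them
(`IsLocalHomeomorph.exists_sections`, `exists_sections_of_le_mfderiv`).  In particular each ball is
contained in or disjoint from the range of `f`, which is therefore all of the connected space `Y`.
-/

noncomputable section

/-! ### Equivalent norms and indicators of linear operators -/

namespace IsEquivalentNorm

variable {E : Type*} [NormedAddCommGroup E] [NormedSpace ℝ E] {p : E → ℝ}

theorem nonneg (hp : IsEquivalentNorm p) (v : E) : 0 ≤ p v := by
  obtain ⟨c, hc, h⟩ := hp.exists_lower
  exact (by positivity : 0 ≤ c * ‖v‖).trans (h v)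

theorem map_zero (hp : IsEquivalentNorm p) : p 0 = 0 := by
  simpa using hp.smul_eq 0 0

theorem pos (hp : IsEquivalentNorm p) {v : E} (hv : v ≠ 0) : 0 < p v := by
  obtain ⟨c, hc, h⟩ := hp.exists_lower
  exact (by positivity : 0 < c * ‖v‖).trans_le (h v)

/-- The Hahn–Banach theorem for a norm equivalent to the given one: a vector is normed by a
functional whose dual norm is at most one. -/
theorem exists_norming_functional (hp : IsEquivalentNorm p) (v : E) :
    ∃ l : E →L[ℝ] ℝ, l v = p v ∧ ∀ w, |l w| ≤ p w := by
  rcases eq_or_ne v 0 with rfl | hv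
  · exact ⟨0, by simp [hp.map_zero], fun w => by simpa using hp.nonneg w⟩
  obtain ⟨g, hg, hgle⟩ := exists_extension_of_le_sublinear
    (LinearPMap.mkSpanSingleton v (p v) hv) p
    (fun c hc x => by rw [hp.smul_eq, abs_of_pos hc]) hp.add_le (by
      rintro ⟨x, hx⟩
      obtain ⟨c, rfl⟩ := Submodule.mem_span_singleton.1 hx
      refine (LinearPMap.mkSpanSingleton'_apply (σ := RingHom.id ℝ) v (p v) _ c hx).trans_le ?_
      rw [hp.smul_eq, RingHom.id_apply, smul_eq_mul]
      exact mul_le_mul_of_nonneg_right (le_abs_self c) (hp.nonneg v))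
  have habs : ∀ w, |g w| ≤ p w := fun w => by
    refine abs_le'.2 ⟨hgle w, ?_⟩
    have := hgle (-w)
    rwa [map_neg, ← neg_one_smul ℝ w, hp.smul_eq, abs_neg, abs_one, one_mul] at this
  obtain ⟨C, -, hC⟩ := hp.exists_upper
  refine ⟨g.mkContinuous C fun w => (habs w).trans (hC w), ?_, habs⟩
  exact (hg ⟨v, Submodule.mem_span_singleton_self v⟩).trans
    (LinearPMap.mkSpanSingleton_apply ℝ ℝ hv (p v))

end IsEquivalentNorm

/-- The dual norm of a functional `l` with respect to a norm `p`, as an extended number. -/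
def dualENorm {E : Type*} [NormedAddCommGroup E] [NormedSpace ℝ E] (p : E → ℝ)
    (l : E →L[ℝ] ℝ) : ℝ≥0∞ :=
  ⨆ (v : E) (_ : p v ≤ 1), ENNReal.ofReal |l v|

section Indicators

variable {E : Type*} [NormedAddCommGroup E] [NormedSpace ℝ E] {p : E → ℝ}
  {F : Type*} [NormedAddCommGroup F] [NormedSpace ℝ F] {q : F → ℝ}

theorem dualENorm_smul (p : E → ℝ) (c : ℝ) (l : E →L[ℝ] ℝ) :
    dualENorm p (c • l) = ENNReal.ofReal |c| * dualENorm p l := by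
  simp only [dualENorm, ENNReal.mul_iSup, _root_.smul_apply, smul_eq_mul, abs_mul,
    ENNReal.ofReal_mul (abs_nonneg c)]

theorem dualENorm_le_iff (hp : IsEquivalentNorm p) (l : E →L[ℝ] ℝ) {D : ℝ} (hD : 0 ≤ D) :
    dualENorm p l ≤ ENNReal.ofReal D ↔ ∀ v, |l v| ≤ D * p v := by
  simp only [dualENorm, iSup_le_iff, ENNReal.ofReal_le_ofReal_iff hD]
  refine ⟨fun h v => ?_, fun h v hv => (h v).trans (mul_le_of_le_one_right hD hv)⟩
  rcases eq_or_ne v 0 with rfl | hv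
  · simp [hp.map_zero]
  have hpv := hp.pos hv
  have := h ((p v)⁻¹ • v) (by
    rw [hp.smul_eq, abs_of_pos (inv_pos.2 hpv), inv_mul_cancel₀ hpv.ne'])
  rw [map_smul, smul_eq_mul, abs_mul, abs_of_pos (inv_pos.2 hpv)] at this
  rwa [inv_mul_le_iff₀ hpv, mul_comm] at this

theorem dualENorm_ne_top (hp : IsEquivalentNorm p) (l : E →L[ℝ] ℝ) : dualENorm p l ≠ ⊤ := by
  obtain ⟨c, hc, h⟩ := hp.exists_lower
  refine ne_top_of_le_ne_top ENNReal.ofReal_ne_top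
    ((dualENorm_le_iff hp l (D := ‖l‖ * c⁻¹) (by positivity)).2 fun v => ?_)
  calc |l v| ≤ ‖l‖ * ‖v‖ := l.le_opNorm v
    _ = ‖l‖ * c⁻¹ * (c * ‖v‖) := by field_simp
    _ ≤ ‖l‖ * c⁻¹ * p v := by gcongr; exact h v

/-- A Fredholm operator of index zero is bijective as soon as it is injective or surjective. -/
theorem ContinuousLinearMap.IsFredholm.bijective_of_index_eq_zero {T : E →L[ℝ] F}
    (hT : T.IsFredholm) (hi : T.toLinearMap.index = 0)
    (h : Function.Injective T ∨ Function.Surjective T) : Function.Bijective T := by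
  have := hT.finite_ker
  have hfin : Module.Finite ℝ (F ⧸ T.range) := hT.finite_coker
  rcases h with h | h
  · refine ⟨h, ?_⟩
    rw [LinearMap.index_of_injective (f := T.toLinearMap) h] at hi
    have h0 : Module.finrank ℝ (F ⧸ T.range) = 0 := by exact_mod_cast neg_eq_zero.1 hi
    rw [Module.finrank_zero_iff, Submodule.Quotient.subsingleton_iff] at h0
    exact LinearMap.range_eq_top.1 h0
  · refine ⟨?_, h⟩
    rw [LinearMap.index_of_surjective (f := T.toLinearMap) h] at hi
    have h0 : Module.finrank ℝ T.ker = 0 := by exact_mod_cast hi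
    rw [Submodule.finrank_eq_zero] at h0
    exact LinearMap.ker_eq_bot.1 h0

/-- If the injectivity indicator is at least `α`, then `T` expands norms by at least `α`. -/
theorem le_map_of_le_injIndicator (hp : IsEquivalentNorm p) (hq : IsEquivalentNorm q)
    (T : E →L[ℝ] F) {α : ℝ}
    (h : ENNReal.ofReal α ≤ ⨅ (v : E) (_ : p v = 1), ENNReal.ofReal (q (T v))) (v : E) :
    α * p v ≤ q (T v) := by
  rcases eq_or_ne v 0 with rfl | hv
  · simp [hp.map_zero, hq.map_zero]
  have hpv := hp.pos hv
  have h1 : p ((p v)⁻¹ • v) = 1 := by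
    rw [hp.smul_eq, abs_of_pos (inv_pos.2 hpv), inv_mul_cancel₀ hpv.ne']
  have := (ENNReal.ofReal_le_ofReal_iff (hq.nonneg _)).1 (h.trans (iInf₂_le_of_le _ h1 le_rfl))
  rw [map_smul, hq.smul_eq, abs_of_pos (inv_pos.2 hpv)] at this
  rw [le_inv_mul_iff₀ hpv] at this
  linarith

/-- If the surjectivity indicator is at least `α`, then the transpose of `T` expands dual norms by
at least `α`. -/
theorem mul_dualENorm_le_of_le_surIndicator (hq : IsEquivalentNorm q) (T : E →L[ℝ] F) {α : ℝ}
    (h : ENNReal.ofReal α ≤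
      ⨅ (l : F →L[ℝ] ℝ) (_ : dualENorm q l = 1), dualENorm p (l.comp T)) (l : F →L[ℝ] ℝ) :
    ENNReal.ofReal α * dualENorm q l ≤ dualENorm p (l.comp T) := by
  rcases eq_or_ne (dualENorm q l) 0 with h0 | h0
  · simp [h0]
  have htop := dualENorm_ne_top hq l
  set D := (dualENorm q l).toReal with hD
  have hDpos : 0 < D := ENNReal.toReal_pos h0 htop
  have hDeq : dualENorm q l = ENNReal.ofReal D := (ENNReal.ofReal_toReal htop).symm
  have h1 : dualENorm q (D⁻¹ • l) = 1 := by
    rw [dualENorm_smul, hDeq, ← ENNReal.ofReal_mul (abs_nonneg _), abs_of_pos (inv_pos.2 hDpos),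
      inv_mul_cancel₀ hDpos.ne', ENNReal.ofReal_one]
  have h2 := h.trans (iInf₂_le_of_le _ h1 le_rfl)
  rw [ContinuousLinearMap.smul_comp, dualENorm_smul, abs_of_pos (inv_pos.2 hDpos)] at h2
  calc ENNReal.ofReal α * dualENorm q l
      ≤ ENNReal.ofReal D⁻¹ * dualENorm p (l.comp T) * ENNReal.ofReal D := by rw [hDeq]; gcongr
    _ = dualENorm p (l.comp T) := by
      rw [mul_right_comm, ← ENNReal.ofReal_mul (inv_pos.2 hDpos).le, inv_mul_cancel₀ hDpos.ne',
        ENNReal.ofReal_one, one_mul]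

/-- A Fredholm operator of index zero one of whose indicators is at least `α > 0` is bijective and
expands norms by at least `α`.  If the surjectivity indicator is bounded below, then no nonzero
functional vanishes on the closed range, so `T` is onto, and the bound follows by applying the
bound for the transpose to `m ∘ T⁻¹`, where `m` is a norming functional. -/
theorem bijective_and_le_map_of_le_indicator [CompleteSpace E] [CompleteSpace F]
    (hp : IsEquivalentNorm p) (hq : IsEquivalentNorm q) (T : E →L[ℝ] F) (hT : T.IsFredholm)
    (hi : T.toLinearMap.index = 0) {α : ℝ} (hα : 0 < α)
    (h : ENNReal.ofReal α ≤ (⨅ (v : E) (_ : p v = 1), ENNReal.ofReal (q (T v))) ∨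
      ENNReal.ofReal α ≤
        ⨅ (l : F →L[ℝ] ℝ) (_ : dualENorm q l = 1), dualENorm p (l.comp T)) :
    Function.Bijective T ∧ ∀ v, α * p v ≤ q (T v) := by
  rcases h with h | h
  · have hle := le_map_of_le_injIndicator hp hq T h
    refine ⟨hT.bijective_of_index_eq_zero hi (.inl ?_), hle⟩
    refine (injective_iff_map_eq_zero T).2 fun v hv => by_contra fun hv0 => ?_
    have h1 := hle v
    rw [hv, hq.map_zero] at h1
    exact absurd (mul_pos hα (hp.pos hv0)) h1.not_gt
  have hle := mul_dualENorm_le_of_le_surIndicator hq T h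
  have hα' : ENNReal.ofReal α ≠ 0 := by simpa using hα
  have hsurj : Function.Surjective T := by
    by_contra hns
    obtain ⟨y, hy⟩ := not_forall.1 hns
    have hy' : y ∉ (T.range : Set F) := hy
    obtain ⟨l, u, hlu, huy⟩ := geometric_hahn_banach_closed_point
      (T.range.convex) hT.isClosed_range hy'
    -- A functional which is bounded above on a subspace vanishes there.
    have hl0 : ∀ v, l (T v) = 0 := fun v => by
      by_contra hne
      have := hlu (T (((u + 1) / l (T v)) • v)) ⟨_, rfl⟩
      rw [map_smul, map_smul, smul_eq_mul, div_mul_cancel₀ _ hne] at this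
      linarith
    have hu : 0 < u := by simpa using hlu (T 0) ⟨_, rfl⟩
    have h0 : dualENorm p (l.comp T) = 0 := by
      rw [← nonpos_iff_eq_zero, ← ENNReal.ofReal_zero, dualENorm_le_iff hp _ le_rfl]
      intro v; simp [hl0]
    have h1 := hle l
    rw [h0, nonpos_iff_eq_zero, mul_eq_zero, or_iff_right hα', ← nonpos_iff_eq_zero,
      ← ENNReal.ofReal_zero, dualENorm_le_iff hq _ le_rfl] at h1
    have h2 := h1 y
    rw [zero_mul] at h2
    have := abs_nonpos_iff.1 h2
    linarith
  have hbij := hT.bijective_of_index_eq_zero hi (.inr hsurj)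
  refine ⟨hbij, fun v => ?_⟩
  let e : E ≃L[ℝ] F := ContinuousLinearEquiv.ofBijective T
    (LinearMap.ker_eq_bot.2 hbij.1) (LinearMap.range_eq_top.2 hbij.2)
  have he : ∀ w, e.symm (T w) = w := fun w => e.symm_apply_apply w
  obtain ⟨m, hmv, hm⟩ := hp.exists_norming_functional v
  let l : F →L[ℝ] ℝ := m.comp (e.symm : F →L[ℝ] E)
  have hl : l.comp T = m := by
    ext w; exact congrArg m (he w)
  have hm1 : dualENorm p (l.comp T) ≤ ENNReal.ofReal 1 := by
    rw [hl, dualENorm_le_iff hp _ zero_le_one]; simpa using hm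
  have h3 : dualENorm q l ≤ ENNReal.ofReal α⁻¹ := by
    rw [ENNReal.ofReal_inv_of_pos hα, ENNReal.le_inv_iff_mul_le, mul_comm]
    simpa using (hle l).trans hm1
  have h4 := (dualENorm_le_iff hq l (inv_pos.2 hα).le).1 h3 (T v)
  have h5 : l (T v) = p v := by rw [← hmv]; exact congrArg m (he v)
  rw [h5, abs_of_nonneg (hp.nonneg v), le_inv_mul_iff₀ hα] at h4
  exact h4

end Indicators

/-! ### Finsler norms in charts -/

section Charts

variable {E : Type*} [NormedAddCommGroup E] [NormedSpace ℝ E]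
  {X : Type*} [TopologicalSpace X] [ChartedSpace E X]

theorem OpenPartialHomeomorph.mdifferentiable_of_mem_maximalAtlas
    {φ : OpenPartialHomeomorph X E} (hφ : φ ∈ IsManifold.maximalAtlas 𝓘(ℝ, E) 1 X) :
    φ.MDifferentiable 𝓘(ℝ, E) 𝓘(ℝ, E) :=
  ⟨(contMDiffOn_of_mem_maximalAtlas hφ).mdifferentiableOn one_ne_zero,
    (contMDiffOn_symm_of_mem_maximalAtlas hφ).mdifferentiableOn one_ne_zero⟩

/-- A tangent vector is represented in a chart by its image under the differential of the chart. -/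
theorem chartVector_mfderiv {φ : OpenPartialHomeomorph X E}
    (hφ : φ ∈ IsManifold.maximalAtlas 𝓘(ℝ, E) 1 X) {x : X} (hx : x ∈ φ.source)
    (v : TangentSpace 𝓘(ℝ, E) x) :
    chartVector φ x (mfderiv 𝓘(ℝ, E) 𝓘(ℝ, E) φ x v) = ⟨x, v⟩ := by
  have h := OpenPartialHomeomorph.mdifferentiable_of_mem_maximalAtlas hφ
  refine Bundle.TotalSpace.ext (φ.left_inv hx) (heq_of_eq ?_)
  exact congrArg (fun A : E →L[ℝ] E => A v) (h.symm_comp_deriv hx)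

namespace FinslerStructure

variable [IsManifold 𝓘(ℝ, E) 1 X] (N : FinslerStructure E X)

theorem norm_eq_chartVector {φ : OpenPartialHomeomorph X E}
    (hφ : φ ∈ IsManifold.maximalAtlas 𝓘(ℝ, E) 1 X) {x : X} (hx : x ∈ φ.source)
    (v : TangentSpace 𝓘(ℝ, E) x) :
    N.norm x v = N.toFun (chartVector φ x (mfderiv 𝓘(ℝ, E) 𝓘(ℝ, E) φ x v)) := by
  rw [chartVector_mfderiv hφ hx, norm]

/-- The Finsler norm on `T_x X` is equivalent to the norm of the model space, with which the type
`T_x X` is identified by the preferred chart at `x`. -/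
theorem isEquivalentNorm_norm (x : X) : IsEquivalentNorm (E := E) (N.norm x) := by
  have hφ := IsManifold.chart_mem_maximalAtlas (I := 𝓘(ℝ, E)) (n := 1) x
  have hx := mem_chart_source E x
  let A : E ≃L[ℝ] E :=
    (OpenPartialHomeomorph.mdifferentiable_of_mem_maximalAtlas hφ).mfderiv hx
  have h := N.admissible _ hφ x hx
  have key : ∀ v : E, N.norm x v = N.toFun (chartVector (chartAt E x) x (A v)) :=
    fun v => N.norm_eq_chartVector hφ hx v
  obtain ⟨c, hc, hlow⟩ := h.exists_lower
  obtain ⟨C, hC, hupp⟩ := h.exists_upper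
  refine ⟨fun v w => ?_, fun a v => ?_, ?_, ?_⟩
  · rw [key, key, key, map_add]; exact h.add_le _ _
  · rw [key, key, map_smul]; exact h.smul_eq _ _
  · refine ⟨c * (‖(A.symm : E →L[ℝ] E)‖ + 1)⁻¹, by positivity, fun v => ?_⟩
    rw [key]
    refine le_trans ?_ (hlow _)
    rw [mul_assoc]
    gcongr
    rw [inv_mul_le_iff₀ (by positivity)]
    calc ‖v‖ = ‖(A.symm : E →L[ℝ] E) (A v)‖ := by simp
      _ ≤ ‖(A.symm : E →L[ℝ] E)‖ * ‖A v‖ := ContinuousLinearMap.le_opNorm _ _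
      _ ≤ _ := by gcongr; linarith
  · refine ⟨C * (‖(A : E →L[ℝ] E)‖ + 1), by positivity, fun v => ?_⟩
    rw [key, mul_assoc]
    refine (hupp _).trans ?_
    gcongr
    calc ‖A v‖ ≤ ‖(A : E →L[ℝ] E)‖ * ‖v‖ := ContinuousLinearMap.le_opNorm (A : E →L[ℝ] E) v
      _ ≤ _ := by gcongr; linarith

/-- Near each point there is a chart in which the Finsler norms of all tangent spaces are uniformly
equivalent to the norm of the model space. -/
theorem exists_chart_equivalent (x₀ : X) :
    ∃ φ ∈ IsManifold.maximalAtlas 𝓘(ℝ, E) 1 X, x₀ ∈ φ.source ∧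
      ∃ c C : ℝ, 0 < c ∧ 0 < C ∧ ∀ x ∈ φ.source, ∀ v : TangentSpace 𝓘(ℝ, E) x,
        c * Norm.norm (E := E) (mfderiv 𝓘(ℝ, E) 𝓘(ℝ, E) φ x v) ≤ N.norm x v ∧
        N.norm x v ≤ C * Norm.norm (E := E) (mfderiv 𝓘(ℝ, E) 𝓘(ℝ, E) φ x v) := by
  obtain ⟨φ, hφ, hx₀, h⟩ := N.locally_almost_constant x₀ 2 one_lt_two
  obtain ⟨c, hc, hlow⟩ := (N.admissible φ hφ x₀ hx₀).exists_lower
  obtain ⟨C, hC, hupp⟩ := (N.admissible φ hφ x₀ hx₀).exists_upper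
  refine ⟨φ, hφ, hx₀, 2⁻¹ * c, 2 * C, by positivity, by positivity, fun x hx v => ?_⟩
  rw [N.norm_eq_chartVector hφ hx]
  obtain ⟨h1, h2⟩ := h x hx (mfderiv 𝓘(ℝ, E) 𝓘(ℝ, E) φ x v)
  constructor
  · refine le_trans ?_ h1
    rw [mul_assoc]
    gcongr
    exact hlow _
  · refine h2.trans ?_
    rw [mul_assoc]
    gcongr
    exact hupp _

/-! ### The Finsler distance -/

/-- The Finsler norms as extended norms on the tangent spaces. -/
@[reducible] def tangentENorm (z : X) : ENorm (TangentSpace 𝓘(ℝ, E) z) :=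
  ⟨fun v => ENNReal.ofReal (N.norm z v)⟩

theorem tangentENormSMulClass (z : X) :
    letI := N.tangentENorm z
    ENormSMulClass ℝ (TangentSpace 𝓘(ℝ, E) z) :=
  let := N.tangentENorm z
  ⟨fun a v => by
    change ENNReal.ofReal (N.norm z (a • v)) = ‖a‖ₑ * ENNReal.ofReal (N.norm z v)
    rw [Real.enorm_eq_ofReal_abs, ← ENNReal.ofReal_mul (abs_nonneg a)]
    exact congrArg _ ((N.isEquivalentNorm_norm z).smul_eq a v)⟩

theorem edist_comm (x y : X) : N.edist x y = N.edist y x := by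
  let := N.tangentENorm
  have := N.tangentENormSMulClass
  exact Manifold.riemannianEDist_comm

/-- The Finsler distance between the endpoints of a `C^1` path of speed at most `C`. -/
theorem edist_le_of_norm_le {γ : ℝ → X} {a b C : ℝ} (hab : a ≤ b)
    (hγ : ContMDiffOn 𝓘(ℝ, ℝ) 𝓘(ℝ, E) 1 γ (Set.Icc a b))
    (hC : ∀ t ∈ Set.Icc a b,
      N.norm (γ t) (mfderivWithin 𝓘(ℝ, ℝ) 𝓘(ℝ, E) γ (Set.Icc a b) t (1 : ℝ)) ≤ C) :
    N.edist (γ a) (γ b) ≤ ENNReal.ofReal (C * (b - a)) := by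
  let := N.tangentENorm
  have := N.tangentENormSMulClass
  refine (Manifold.riemannianEDist_le_pathELength hγ rfl rfl hab).trans ?_
  rw [Manifold.pathELength_eq_lintegral_mfderivWithin_Icc]
  refine (MeasureTheory.setLIntegral_mono' (g := fun _ => ENNReal.ofReal C) measurableSet_Icc
    fun t ht => ENNReal.ofReal_le_ofReal (hC t ht)).trans ?_
  rw [MeasureTheory.setLIntegral_const, Real.volume_Icc,
    ← ENNReal.ofReal_mul' (sub_nonneg.2 hab)]

end FinslerStructure

end Charts

section Topology

open Set MeasureTheory

variable {E : Type*} [NormedAddCommGroup E] [NormedSpace ℝ E]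
  {X : Type*} [TopologicalSpace X] [ChartedSpace E X] [IsManifold 𝓘(ℝ, E) 1 X]

namespace FinslerStructure

variable (N : FinslerStructure E X)

/-- Points at small Finsler distance from `x` are close to `x` in the topology of `X`: in a chart
where the Finsler norm dominates a multiple of the norm of `E`, a short path starting at `x` has no
time to leave a small ball. -/
theorem exists_forall_edist_lt_mem [RegularSpace X] {x : X} {s : Set X} (hs : s ∈ 𝓝 x) :
    ∃ ε : ℝ≥0∞, 0 < ε ∧ ∀ y, N.edist x y < ε → y ∈ s := by
  let := N.tangentENorm
  have := N.tangentENormSMulClass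
  obtain ⟨φ, hφ, hxφ, c, _, hc, -, hcC⟩ := N.exists_chart_equivalent x
  obtain ⟨u, u_mem, u_closed, hu⟩ :=
    exists_mem_nhds_isClosed_subset (Filter.inter_mem hs (φ.open_source.mem_nhds hxφ))
  obtain ⟨us, uφ⟩ := subset_inter_iff.1 hu
  -- A path that is short enough is shown to stay in the open neighbourhood `v` of `x`.
  -- The closed neighbourhood `u` is needed for induction on the time interval.
  obtain ⟨v, ⟨v_mem, v_open⟩, hv⟩ : ∃ v, (v ∈ 𝓝 x ∧ IsOpen v) ∧ v ⊆ u :=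
    (nhds_basis_opens' x).mem_iff.1 u_mem
  obtain ⟨r, r_pos, hr⟩ : ∃ r > 0, Metric.ball (φ x) r ⊆ φ.symm ⁻¹' v :=
    Metric.mem_nhds_iff.1 <| (φ.continuousAt_symm (φ.map_source hxφ)).preimage_mem_nhds
      (by rwa [φ.left_inv hxφ])
  refine ⟨ENNReal.ofReal (c * r), by simpa using mul_pos hc r_pos, fun y hy => ?_⟩
  obtain ⟨γ, hγx, hγy, γ_smooth, hγ, -⟩ :=
    Manifold.exists_lt_locally_constant_of_riemannianEDist_lt hy zero_lt_one
  have A_closed : IsClosed (γ ⁻¹' u ∩ Icc 0 1) :=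
    (u_closed.preimage γ_smooth.continuous).inter isClosed_Icc
  have zero_mem : (0 : ℝ) ∈ γ ⁻¹' u := by simpa [hγx] using mem_of_mem_nhds u_mem
  suffices Icc 0 1 ⊆ γ ⁻¹' u by
    have h1 : (1 : ℝ) ∈ γ ⁻¹' u := this ⟨zero_le_one, le_rfl⟩
    exact us (hγy ▸ h1)
  apply A_closed.Icc_subset_of_forall_mem_nhdsGT_of_Icc_subset zero_mem
  rintro T ⟨hT0, hT1⟩ hTu
  suffices γ T ∈ v from
    γ_smooth.continuous.continuousWithinAt <| Filter.mem_of_superset (v_open.mem_nhds this) hv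
  have hγ' : ContDiffOn ℝ 1 (φ ∘ γ) (Icc 0 T) := by
    rw [← contMDiffOn_iff_contDiffOn]
    exact (contMDiffOn_of_mem_maximalAtlas hφ).comp γ_smooth.contMDiffOn fun t ht => uφ (hTu ht)
  have hlen : ENNReal.ofReal c * ‖(φ ∘ γ) T - (φ ∘ γ) 0‖ₑ < ENNReal.ofReal (c * r) := by
    rcases hT0.eq_or_lt with rfl | hT
    · simpa using mul_pos hc r_pos
    calc ENNReal.ofReal c * ‖(φ ∘ γ) T - (φ ∘ γ) 0‖ₑ
        ≤ ENNReal.ofReal c * ∫⁻ t in Icc 0 T, ‖derivWithin (φ ∘ γ) (Icc 0 T) t‖ₑ := by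
          gcongr
          exact enorm_sub_le_lintegral_derivWithin_Icc_of_contDiffOn_Icc hγ' hT0
      _ = ∫⁻ t in Icc 0 T, ENNReal.ofReal c * ‖derivWithin (φ ∘ γ) (Icc 0 T) t‖ₑ :=
          (lintegral_const_mul' _ _ ENNReal.ofReal_ne_top).symm
      _ ≤ ∫⁻ t in Icc 0 T, ENNReal.ofReal (N.norm (γ t)
            (mfderivWithin 𝓘(ℝ, ℝ) 𝓘(ℝ, E) γ (Icc 0 T) t (1 : ℝ))) := by
          refine setLIntegral_mono' measurableSet_Icc fun t ht => ?_
          have hd : mfderivWithin 𝓘(ℝ, ℝ) 𝓘(ℝ, E) (φ ∘ γ) (Icc 0 T) t =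
              (mfderiv 𝓘(ℝ, E) 𝓘(ℝ, E) φ (γ t)) ∘L
                (mfderivWithin 𝓘(ℝ, ℝ) 𝓘(ℝ, E) γ (Icc 0 T) t) := by
            apply mfderiv_comp_mfderivWithin
            · exact (OpenPartialHomeomorph.mdifferentiable_of_mem_maximalAtlas
                hφ).mdifferentiableAt (uφ (hTu ht))
            · exact (γ_smooth.mdifferentiable one_ne_zero).mdifferentiableOn _ ht
            · rw [uniqueMDiffWithinAt_iff_uniqueDiffWithinAt]
              exact uniqueDiffOn_Icc hT _ ht
          have hd' : derivWithin (φ ∘ γ) (Icc 0 T) t = mfderiv 𝓘(ℝ, E) 𝓘(ℝ, E) φ (γ t)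
              (mfderivWithin 𝓘(ℝ, ℝ) 𝓘(ℝ, E) γ (Icc 0 T) t (1 : ℝ)) := by
            rw [← fderivWithin_derivWithin, ← mfderivWithin_eq_fderivWithin]
            exact congrArg (fun A : ℝ →L[ℝ] E => A 1) hd
          rw [← ofReal_norm, ← ENNReal.ofReal_mul hc.le]
          exact ENNReal.ofReal_le_ofReal <| (congrArg (fun e : E => c * ‖e‖) hd').trans_le
            (hcC _ (uφ (hTu ht)) _).1
      _ = Manifold.pathELength 𝓘(ℝ, E) γ 0 T :=
          by rw [Manifold.pathELength_eq_lintegral_mfderivWithin_Icc]; rfl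
      _ ≤ Manifold.pathELength 𝓘(ℝ, E) γ 0 1 := Manifold.pathELength_mono le_rfl hT1.le
      _ < ENNReal.ofReal (c * r) := hγ
  have hball : φ (γ T) ∈ Metric.ball (φ x) r := by
    rw [← ofReal_norm, ← ENNReal.ofReal_mul hc.le,
      ENNReal.ofReal_lt_ofReal_iff (mul_pos hc r_pos)] at hlen
    have := lt_of_mul_lt_mul_left hlen hc.le
    rwa [Function.comp_apply, Function.comp_apply, hγx, ← dist_eq_norm] at this
  have := hr hball
  rwa [mem_preimage, φ.left_inv (uφ (hTu (right_mem_Icc.2 hT0)))] at this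

end FinslerStructure

end Topology

/-! ### Path lifting along local homeomorphisms -/

section Lifting

open Set Filter

variable {X Y : Type*} [TopologicalSpace X] [TopologicalSpace Y] {f : X → Y}

namespace IsLocalHomeomorph

/-- Two continuous lifts of a path on an interval that agree at one point agree everywhere. -/
theorem eqOn_lift [T2Space X] (hf : IsLocalHomeomorph f) {s : Set ℝ} (hs : s.OrdConnected)
    {γ : ℝ → Y} {Γ₁ Γ₂ : ℝ → X} (h₁ : ContinuousOn Γ₁ s) (h₂ : ContinuousOn Γ₂ s)
    (hl₁ : ∀ t ∈ s, f (Γ₁ t) = γ t) (hl₂ : ∀ t ∈ s, f (Γ₂ t) = γ t)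
    {a : ℝ} (ha : a ∈ s) (h : Γ₁ a = Γ₂ a) : EqOn Γ₁ Γ₂ s :=
  (T2Space.isSeparatedMap f).eqOn_of_comp_eqOn hf.isLocallyInjective hs.isPreconnected h₁ h₂
    (fun t ht => (hl₁ t ht).trans (hl₂ t ht).symm) ha h

/-- A lift on `[0, a]` whose endpoint lies in the domain of a local inverse extends to `[0, b]` if
the local inverse is defined along `γ` on `[a, b]`. -/
theorem exists_lift_extend {q : OpenPartialHomeomorph X Y} {γ : ℝ → Y} {Γ : ℝ → X}
    {a b : ℝ} (ha : 0 ≤ a) (hγ : ContinuousOn γ (Icc a b)) (hΓ : ContinuousOn Γ (Icc 0 a))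
    (hl : ∀ t ∈ Icc 0 a, q (Γ t) = γ t) (hq : Γ a ∈ q.source) (hb : MapsTo γ (Icc a b) q.target) :
    ∃ Γ' : ℝ → X, ContinuousOn Γ' (Icc 0 b) ∧ Γ' 0 = Γ 0 ∧ ∀ t ∈ Icc 0 b, q (Γ' t) = γ t := by
  classical
  have hΓa : Γ a = q.symm (γ a) := by
    rw [← hl a (right_mem_Icc.2 ha), q.left_inv hq]
  have hΓ₂ : ContinuousOn (q.symm ∘ γ) (Icc a b) := q.continuousOn_symm.comp hγ hb
  refine ⟨fun t => if t ≤ a then Γ t else q.symm (γ t), ?_, if_pos ha, fun t ht => ?_⟩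
  · refine ContinuousOn.if (p := fun t => t ≤ a) ?_ (hΓ.mono ?_) (hΓ₂.mono ?_)
    · rintro t ⟨-, ht⟩
      have : t = a := by simpa using frontier_Iic_subset a ht
      rw [this]; exact hΓa
    · rintro t ⟨ht, ht'⟩
      have : t ∈ closure (Iic a) := ht'
      rw [closure_Iic] at this
      exact ⟨ht.1, this⟩
    · rintro t ⟨ht, ht'⟩
      have : t ∈ closure (Ioi a) := by
        convert ht' using 2; ext s; simp
      rw [closure_Ioi] at this
      exact ⟨this, ht.2⟩
  · by_cases h : t ≤ a
    · simp only [if_pos h]; exact hl t ⟨ht.1, h⟩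
    · simp only [if_neg h]; exact q.right_inv (hb ⟨(not_le.1 h).le, ht.2⟩)

/-- Path lifting: a path `γ` on `[0, 1]` lifts through a local homeomorphism if every lift on a
half-open interval `[0, T)` has a cluster point at `T`. -/
theorem exists_lift_Icc [T2Space X] [T2Space Y] (hf : IsLocalHomeomorph f) {γ : ℝ → Y}
    (hγ : ContinuousOn γ (Icc 0 1)) {x₀ : X} (h0 : f x₀ = γ 0)
    (hclus : ∀ T ∈ Ioc (0 : ℝ) 1, ∀ Γ : ℝ → X, ContinuousOn Γ (Ico 0 T) →
      (∀ t ∈ Ico 0 T, f (Γ t) = γ t) → ∃ x, MapClusterPt x (𝓝[<] T) Γ) :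
    ∃ Γ : ℝ → X, ContinuousOn Γ (Icc 0 1) ∧ Γ 0 = x₀ ∧ ∀ t ∈ Icc (0 : ℝ) 1, f (Γ t) = γ t := by
  let P : ℝ → (ℝ → X) → Prop := fun T Γ =>
    ContinuousOn Γ (Icc 0 T) ∧ Γ 0 = x₀ ∧ ∀ t ∈ Icc (0 : ℝ) T, f (Γ t) = γ t
  let S : Set ℝ := {T | T ∈ Icc (0 : ℝ) 1 ∧ ∃ Γ, P T Γ}
  have hS0 : (0 : ℝ) ∈ S := by
    refine ⟨⟨le_rfl, zero_le_one⟩, fun _ => x₀, continuousOn_const, rfl, fun t ht => ?_⟩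
    rw [le_antisymm ht.2 ht.1, h0]
  have hSb : BddAbove S := ⟨1, fun T hT => hT.1.2⟩
  have hSmono : ∀ {T T'}, T ∈ S → 0 ≤ T' → T' ≤ T → T' ∈ S := fun {T T'} hT h0T' hle => by
    obtain ⟨hT1, Γ, hΓ, hΓ0, hΓl⟩ := hT
    exact ⟨⟨h0T', hle.trans hT1.2⟩, Γ, hΓ.mono (Icc_subset_Icc_right hle), hΓ0,
      fun t ht => hΓl t ⟨ht.1, ht.2.trans hle⟩⟩
  set T := sSup S with hT
  have hT0 : 0 ≤ T := le_csSup hSb hS0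
  have hT1 : T ≤ 1 := csSup_le ⟨0, hS0⟩ fun t ht => ht.1.2
  have hlt : ∀ t, 0 ≤ t → t < T → t ∈ S := fun t ht0 ht => by
    obtain ⟨t', ht', htt'⟩ := exists_lt_of_lt_csSup ⟨0, hS0⟩ ht
    exact hSmono ht' ht0 htt'.le
  -- It suffices to find a point `x` over `γ T`, and times `a ≤ T` arbitrarily close to `T` for
  -- which some lift on `[0, a]` ends arbitrarily close to `x`.
  suffices H : ∃ x, f x = γ T ∧ ∀ U ∈ 𝓝 x, ∀ δ > 0, ∃ a ∈ Icc 0 T, T - δ < a ∧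
      ∃ Γ, P a Γ ∧ Γ a ∈ U by
    obtain ⟨x, hx, H⟩ := H
    obtain ⟨q, hxq, rfl⟩ := hf x
    have hqT : q.target ∈ 𝓝 (γ T) := q.open_target.mem_nhds (hx ▸ q.map_source hxq)
    obtain ⟨δ, hδ, hball⟩ := Metric.mem_nhdsWithin_iff.1 (hγ T ⟨hT0, hT1⟩ hqT)
    obtain ⟨a, ha, haδ, Γ, ⟨hΓ, hΓ0, hΓl⟩, hΓa⟩ := H _ (q.open_source.mem_nhds hxq) δ hδ
    set b := min 1 (T + δ / 2) with hb
    have hTb : T ≤ b := le_min hT1 (by linarith)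
    have hab : a ≤ b := ha.2.trans hTb
    obtain ⟨Γ', hΓ', hΓ'0, hΓ'l⟩ := exists_lift_extend (q := q) (γ := γ) (b := b) ha.1
      (hγ.mono (Icc_subset_Icc ha.1 (min_le_left _ _))) hΓ hΓl hΓa (fun t ht => by
        refine hball ⟨?_, ha.1.trans ht.1, ht.2.trans (min_le_left _ _)⟩
        rw [Metric.mem_ball, Real.dist_eq, abs_lt]
        have := ht.2.trans (min_le_right _ _)
        constructor <;> linarith [ht.1])
    have hbS : b ∈ S := ⟨⟨ha.1.trans hab, min_le_left _ _⟩, Γ', hΓ', hΓ'0.trans hΓ0, hΓ'l⟩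
    have hbT : b ≤ T := le_csSup hSb hbS
    have hb1 : b = 1 := by
      rcases min_choice 1 (T + δ / 2) with h | h
      · exact h
      · rw [← hb] at h; linarith
    exact ⟨Γ', hb1 ▸ hΓ', hΓ'0.trans hΓ0, hb1 ▸ hΓ'l⟩
  by_cases hTS : T ∈ S
  · obtain ⟨-, Γ, hΓ⟩ := hTS
    exact ⟨Γ T, hΓ.2.2 T ⟨hT0, le_rfl⟩, fun U hU δ hδ =>
      ⟨T, ⟨hT0, le_rfl⟩, by linarith, Γ, hΓ, mem_of_mem_nhds hU⟩⟩
  have hTpos : 0 < T := hT0.lt_of_ne fun h => hTS (h ▸ hS0)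
  -- The lifts on the intervals `[0, t]` with `t < T` agree, hence define a lift on `[0, T)`.
  have : Nonempty X := ⟨x₀⟩
  choose! L hL using fun (t : ℝ) (ht : t ∈ S) => ht.2
  let Γ : ℝ → X := fun t => L t t
  have hΓL : ∀ t ∈ Ico 0 T, EqOn Γ (L t) (Icc 0 t) := fun t ht s hs => by
    have hs' := hL s (hlt s hs.1 (hs.2.trans_lt ht.2))
    have ht' := hL t (hlt t ht.1 ht.2)
    exact hf.eqOn_lift ordConnected_Icc hs'.1 (ht'.1.mono (Icc_subset_Icc_right hs.2)) hs'.2.2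
      (fun r hr => ht'.2.2 r ⟨hr.1, hr.2.trans hs.2⟩) (left_mem_Icc.2 hs.1)
      (hs'.2.1.trans ht'.2.1.symm) (right_mem_Icc.2 hs.1)
  have hΓl : ∀ t ∈ Ico 0 T, f (Γ t) = γ t := fun t ht =>
    (hL t (hlt t ht.1 ht.2)).2.2 t (right_mem_Icc.2 ht.1)
  have hΓP : ∀ t ∈ Ico 0 T, P t Γ := fun t ht => by
    have h := hL t (hlt t ht.1 ht.2)
    refine ⟨h.1.congr (hΓL t ht), (hΓL t ht (left_mem_Icc.2 ht.1)).trans h.2.1, fun s hs => ?_⟩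
    rw [hΓL t ht hs]; exact h.2.2 s hs
  have hΓc : ContinuousOn Γ (Ico 0 T) := fun t ht => by
    obtain ⟨t', htt', ht'⟩ := exists_between ht.2
    have h := (hΓP t' ⟨ht.1.trans htt'.le, ht'⟩).1 t ⟨ht.1, htt'.le⟩
    refine h.mono_of_mem_nhdsWithin ?_
    filter_upwards [self_mem_nhdsWithin, mem_nhdsWithin_of_mem_nhds (Iio_mem_nhds htt')]
      with s hs hs' using ⟨hs.1, le_of_lt hs'⟩
  obtain ⟨x, hx⟩ := hclus T ⟨hTpos, hT1⟩ Γ hΓc hΓl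
  have hev : ∀ᶠ t in 𝓝[<] T, t ∈ Ico 0 T := by
    filter_upwards [self_mem_nhdsWithin, mem_nhdsWithin_of_mem_nhds (Ioi_mem_nhds hTpos)]
      with t ht ht' using ⟨le_of_lt ht', ht⟩
  refine ⟨x, ?_, fun U hU δ hδ => ?_⟩
  · by_contra hne
    obtain ⟨U, V, hU, hV, hxU, hTV, hUV⟩ := t2_separation hne
    have hγV : ∀ᶠ t in 𝓝[<] T, γ t ∈ V := by
      have h1 : Tendsto γ (𝓝[Ico 0 T] T) (𝓝 (γ T)) :=
        (hγ T ⟨hT0, hT1⟩).mono_left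
          (nhdsWithin_mono T fun t ht => ⟨ht.1, ht.2.le.trans hT1⟩)
      rw [nhdsWithin_Ico_eq_nhdsLT hTpos] at h1
      exact h1 (hV.mem_nhds hTV)
    have hfU : f ⁻¹' U ∈ 𝓝 x := hf.continuous.continuousAt (hU.mem_nhds hxU)
    obtain ⟨t, htU, htV, ht⟩ :=
      ((mapClusterPt_iff_frequently.1 hx _ hfU).and_eventually (hγV.and hev)).exists
    exact hUV.le_bot ⟨(hΓl t ht) ▸ htU, htV⟩
  · have hnear : ∀ᶠ t in 𝓝[<] T, T - δ < t :=
      mem_nhdsWithin_of_mem_nhds (Ioi_mem_nhds (by linarith))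
    obtain ⟨t, htU, htδ, ht⟩ :=
      ((mapClusterPt_iff_frequently.1 hx _ hU).and_eventually (hnear.and hev)).exists
    exact ⟨t, ⟨ht.1, ht.2.le⟩, htδ, Γ, hΓP t ht, htU⟩

end IsLocalHomeomorph

end Lifting

/-! ### Sections of local homeomorphisms over contractible sets -/

section Sheets

open Set unitInterval

variable {X Y : Type*} [TopologicalSpace X] [TopologicalSpace Y] {f : X → Y}

/-- Let `H` contract the set `V` to the point `c`.  If all the paths `t ↦ H (t, v)` lift through
the local homeomorphism `f`, with any prescribed starting point over `c` and any prescribed end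
point over `v`, then `f⁻¹(V)` is the disjoint union of the images of continuous sections over `V`,
one for each point over `c`. -/
theorem IsLocalHomeomorph.exists_sections [T2Space X] (hf : IsLocalHomeomorph f) {V : Set Y}
    {c : Y} (H : C(I × V, Y)) (H0 : ∀ v, H (0, v) = c) (H1 : ∀ v, H (1, v) = v)
    (hstart : ∀ x, f x = c → ∀ v, ∃ Γ : C(I, X), Γ 0 = x ∧ ∀ t, f (Γ t) = H (t, v))
    (hend : ∀ x (v : V), f x = v → ∃ Γ : C(I, X), Γ 1 = x ∧ ∀ t, f (Γ t) = H (t, v)) :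
    ∃ s : f ⁻¹' {c} → V → X, (∀ e, Continuous (s e)) ∧ (∀ e v, f (s e v) = v) ∧
      (∀ e e' v, s e v = s e' v → e = e') ∧ ∀ x (h : f x ∈ V), ∃ e, s e ⟨f x, h⟩ = x := by
  choose Γ hΓ0 hΓ using fun (e : f ⁻¹' {c}) => hstart e e.2
  have huniq : ∀ (v : V) (Γ₁ Γ₂ : C(I, X)), (∀ t, f (Γ₁ t) = H (t, v)) →
      (∀ t, f (Γ₂ t) = H (t, v)) → ∀ a, Γ₁ a = Γ₂ a → ∀ t, Γ₁ t = Γ₂ t :=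
    fun v Γ₁ Γ₂ h₁ h₂ a ha t => congrFun
      ((T2Space.isSeparatedMap f).eq_of_comp_eq hf.isLocallyInjective Γ₁.continuous Γ₂.continuous
        (funext fun t => (h₁ t).trans (h₂ t).symm) a ha) t
  refine ⟨fun e v => Γ e v 1, fun e => ?_, fun e v => (hΓ e v 1).trans (H1 v), ?_, ?_⟩
  -- Lifts that are continuous in `t` and constant at `t = 0` are jointly continuous.
  · have hg : Continuous fun tv : I × V => Γ e tv.2 tv.1 :=
      hf.continuous_lift (T2Space.isSeparatedMap f) H (funext fun tv => hΓ e tv.2 tv.1)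
        (by simp only [hΓ0]; exact continuous_const) fun v => (Γ e v).continuous
    exact hg.comp (continuous_const.prodMk continuous_id)
  · intro e e' v h
    have := huniq v _ _ (hΓ e v) (hΓ e' v) 1 h 0
    rw [hΓ0, hΓ0] at this
    exact Subtype.ext this
  · intro x h
    obtain ⟨Δ, hΔ1, hΔ⟩ := hend x ⟨f x, h⟩ rfl
    let e : f ⁻¹' {c} := ⟨Δ 0, (hΔ 0).trans (H0 _)⟩
    exact ⟨e, (huniq _ _ _ (hΓ e _) hΔ 0 (hΓ0 e _) 1).trans hΔ1⟩

end Sheets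

/-! ### The inverse function theorem on Banach manifolds -/

section InverseFunction

open Set

variable {E : Type*} [NormedAddCommGroup E] [NormedSpace ℝ E]
  {F : Type*} [NormedAddCommGroup F] [NormedSpace ℝ F]
  {X : Type*} [TopologicalSpace X] [ChartedSpace E X]
  {Y : Type*} [TopologicalSpace Y] [ChartedSpace F Y]
  {f : X → Y} {x : X}

/-- In the preferred charts at `x` and `f x`, the differential of `f` at `x` is the derivative of
the local expression of `f`. -/
theorem hasFDerivAt_of_mdifferentiableAt (hd : MDifferentiableAt 𝓘(ℝ, E) 𝓘(ℝ, F) f x) :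
    HasFDerivAt (chartAt F (f x) ∘ f ∘ (chartAt E x).symm)
      (mfderiv 𝓘(ℝ, E) 𝓘(ℝ, F) f x : E →L[ℝ] F) (chartAt E x x) := by
  have h := hd.hasMFDerivAt.2
  refine hasFDerivWithinAt_univ.1 ?_
  simpa [writtenInExtChartAt, hasFDerivWithinAt_univ] using h

theorem contDiffAt_of_contMDiffAt {n : WithTop ℕ∞} (h : ContMDiffAt 𝓘(ℝ, E) 𝓘(ℝ, F) n f x) :
    ContDiffAt ℝ n (chartAt F (f x) ∘ f ∘ (chartAt E x).symm) (chartAt E x x) := by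
  have h' := (contMDiffAt_iff.1 h).2
  simpa [contDiffWithinAt_univ] using h'

variable [CompleteSpace E] [CompleteSpace F]

/-- The differential of `f` at `x`, as an isomorphism of the model spaces. -/
def mfderivEquivOfBijective (f : X → Y) (x : X)
    (hbij : Function.Bijective (mfderiv 𝓘(ℝ, E) 𝓘(ℝ, F) f x)) : E ≃L[ℝ] F :=
  ContinuousLinearEquiv.ofBijective (mfderiv 𝓘(ℝ, E) 𝓘(ℝ, F) f x : E →L[ℝ] F)
    (LinearMap.ker_eq_bot.2 hbij.1) (LinearMap.range_eq_top.2 hbij.2)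

theorem coe_mfderivEquivOfBijective
    (hbij : Function.Bijective (mfderiv 𝓘(ℝ, E) 𝓘(ℝ, F) f x)) :
    (mfderivEquivOfBijective f x hbij : E →L[ℝ] F) = mfderiv 𝓘(ℝ, E) 𝓘(ℝ, F) f x := rfl

/-- The inverse function theorem for maps of Banach manifolds, in its topological part. -/
theorem exists_openPartialHomeomorph_of_bijective_mfderiv
    (hf : ContMDiffAt 𝓘(ℝ, E) 𝓘(ℝ, F) 1 f x)
    (hbij : Function.Bijective (mfderiv 𝓘(ℝ, E) 𝓘(ℝ, F) f x)) :
    ∃ q : OpenPartialHomeomorph X Y, x ∈ q.source ∧ EqOn f q q.source := by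
  have hd := hasFDerivAt_of_mdifferentiableAt (hf.mdifferentiableAt one_ne_zero)
  rw [← coe_mfderivEquivOfBijective hbij] at hd
  let R := (contDiffAt_of_contMDiffAt hf).toOpenPartialHomeomorph _ hd one_ne_zero
  have hR : ⇑R = chartAt F (f x) ∘ f ∘ (chartAt E x).symm := rfl
  have hxR : chartAt E x x ∈ R.source :=
    (contDiffAt_of_contMDiffAt hf).mem_toOpenPartialHomeomorph_source hd one_ne_zero
  have hnhds : f ⁻¹' (chartAt F (f x)).source ∈ 𝓝 x :=
    hf.continuousAt ((chartAt F (f x)).open_source.mem_nhds (mem_chart_source F (f x)))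
  obtain ⟨W, hW, hWo, hxW⟩ := mem_nhds_iff.1 hnhds
  refine ⟨(((chartAt E x).trans R).trans (chartAt F (f x)).symm).restrOpen W hWo, ?_, ?_⟩
  · simp [hxR, hxW, hR]
  · intro z hz
    simp only [OpenPartialHomeomorph.restrOpen_source, OpenPartialHomeomorph.trans_source,
      mem_inter_iff, mem_preimage] at hz
    have hz1 : z ∈ (chartAt E x).source := hz.1.1.1
    have hz2 : f z ∈ (chartAt F (f x)).source := hW hz.2
    simp [hR, hz1, hz2]

/-- A local inverse of a `C^n` map is `C^n` where the differential is bijective. -/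
theorem OpenPartialHomeomorph.contMDiffAt_symm_of_bijective_mfderiv {n : WithTop ℕ∞}
    (hn : n ≠ 0) (q : OpenPartialHomeomorph X Y) (hx : x ∈ q.source)
    (hq : ContMDiffAt 𝓘(ℝ, E) 𝓘(ℝ, F) n q x)
    (hbij : Function.Bijective (mfderiv 𝓘(ℝ, E) 𝓘(ℝ, F) q x)) :
    ContMDiffAt 𝓘(ℝ, F) 𝓘(ℝ, E) n q.symm (q x) := by
  have hd := hasFDerivAt_of_mdifferentiableAt (hq.mdifferentiableAt hn)
  have hc := contDiffAt_of_contMDiffAt hq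
  rw [← coe_mfderivEquivOfBijective hbij] at hd
  let R : OpenPartialHomeomorph E F := ((chartAt E x).symm.trans q).trans (chartAt F (q x))
  have ha : chartAt F (q x) (q x) ∈ R.target := by
    simp [R, hx]
  have hRa : R.symm (chartAt F (q x) (q x)) = chartAt E x x := by
    simp [R, hx]
  have h := R.contDiffAt_symm (n := n) ha (by rw [hRa]; exact hd) (by rw [hRa]; exact hc)
  rw [contMDiffAt_iff]
  refine ⟨q.continuousAt_symm (q.map_source hx), ?_⟩
  rw [q.left_inv hx]
  have h' : ContDiffAt ℝ n (chartAt E x ∘ q.symm ∘ (chartAt F (q x)).symm)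
      (chartAt F (q x) (q x)) := h
  simpa [contDiffWithinAt_univ] using h'

/-- A `C^1` map all of whose differentials are bijective is a local homeomorphism. -/
theorem isLocalHomeomorph_of_bijective_mfderiv (hf : ContMDiff 𝓘(ℝ, E) 𝓘(ℝ, F) 1 f)
    (hbij : ∀ x, Function.Bijective (mfderiv 𝓘(ℝ, E) 𝓘(ℝ, F) f x)) : IsLocalHomeomorph f :=
  IsLocalHomeomorph.mk _ fun x =>
    exists_openPartialHomeomorph_of_bijective_mfderiv (hf x) (hbij x)

/-- Continuous lifts of `C^n` maps through a `C^n` map with bijective differentials are `C^n`. -/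
theorem IsLocalHomeomorph.contMDiffOn_lift {n : WithTop ℕ∞} (hn : n ≠ 0)
    (hf : IsLocalHomeomorph f) (hfn : ContMDiff 𝓘(ℝ, E) 𝓘(ℝ, F) n f)
    (hbij : ∀ x, Function.Bijective (mfderiv 𝓘(ℝ, E) 𝓘(ℝ, F) f x))
    {G : Type*} [NormedAddCommGroup G] [NormedSpace ℝ G]
    {M : Type*} [TopologicalSpace M] [ChartedSpace G M] {s : Set M} {γ : M → Y} {Γ : M → X}
    (hγ : ContMDiffOn 𝓘(ℝ, G) 𝓘(ℝ, F) n γ s) (hΓ : ContinuousOn Γ s)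
    (hl : ∀ t ∈ s, f (Γ t) = γ t) : ContMDiffOn 𝓘(ℝ, G) 𝓘(ℝ, E) n Γ s := by
  intro t ht
  obtain ⟨q, hq, rfl⟩ := hf (Γ t)
  have hsymm := q.contMDiffAt_symm_of_bijective_mfderiv hn hq (hfn _) (hbij _)
  rw [hl t ht] at hsymm
  refine (hsymm.comp_contMDiffWithinAt t (hγ t ht)).congr_of_eventuallyEq ?_ ?_
  · filter_upwards [hΓ t ht (q.open_source.mem_nhds hq), self_mem_nhdsWithin] with r hr hrs
    rw [Function.comp_apply, ← hl r hrs, q.left_inv hr]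
  · rw [Function.comp_apply, ← hl t ht, q.left_inv hq]

end InverseFunction

/-! ### Lifting segments under the Earle–Eells condition -/

section Segments

open Set Filter

variable {E : Type*} [NormedAddCommGroup E] [NormedSpace ℝ E]
  {X : Type*} [TopologicalSpace X] [ChartedSpace E X] [IsManifold 𝓘(ℝ, E) 1 X]
  {F : Type*} [NormedAddCommGroup F] [NormedSpace ℝ F]
  {Y : Type*} [TopologicalSpace Y] [ChartedSpace F Y] [IsManifold 𝓘(ℝ, F) 1 Y]

namespace FinslerStructure

variable (N : FinslerStructure E X) (NY : FinslerStructure F Y)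

/-- The speed at time `t` of a path, computed from the one-sided derivative at the ends of
`[a, b]`. -/
def speedWithin (γ : ℝ → X) (a b t : ℝ) : ℝ :=
  N.toFun (tangentMapWithin 𝓘(ℝ, ℝ) 𝓘(ℝ, E) γ (Icc a b) ⟨t, (1 : ℝ)⟩)

theorem speedWithin_eq (γ : ℝ → X) (a b t : ℝ) : N.speedWithin γ a b t =
    N.norm (γ t) (mfderivWithin 𝓘(ℝ, ℝ) 𝓘(ℝ, E) γ (Icc a b) t (1 : ℝ)) := rfl

variable {N} in
theorem speedWithin_congr {γ γ' : ℝ → X} {a b t : ℝ} (h : EqOn γ γ' (Icc a b))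
    (ht : t ∈ Icc a b) : N.speedWithin γ a b t = N.speedWithin γ' a b t :=
  congrArg N.toFun (tangentMapWithin_congr h _ ht)

variable {N NY} in
/-- If the differential of `f` expands norms by at least `α`, then `f` expands the speed of paths
by at least `α`. -/
theorem mul_speedWithin_le {f : X → Y} (hf : ContMDiff 𝓘(ℝ, E) 𝓘(ℝ, F) 1 f) {Γ : ℝ → X}
    {a b t α : ℝ} (hab : a < b) (hΓ : ContMDiffOn 𝓘(ℝ, ℝ) 𝓘(ℝ, E) 1 Γ (Icc a b))
    (ht : t ∈ Icc a b)
    (hα : ∀ v, α * N.norm (Γ t) v ≤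
      NY.norm (f (Γ t)) (mfderiv 𝓘(ℝ, E) 𝓘(ℝ, F) f (Γ t) v)) :
    α * N.speedWithin Γ a b t ≤ NY.speedWithin (f ∘ Γ) a b t := by
  rw [speedWithin_eq, speedWithin_eq,
    mfderiv_comp_mfderivWithin t (hf.mdifferentiable one_ne_zero _)
    (hΓ.mdifferentiableOn one_ne_zero t ht)
    ((uniqueMDiffWithinAt_iff_uniqueDiffWithinAt).2 (uniqueDiffOn_Icc hab t ht))]
  exact hα _

variable {N} in
/-- The speed of a segment in a chart in which `C` times the norm of `E` dominates the Finsler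
norms. -/
theorem speedWithin_segment_le {φ : OpenPartialHomeomorph X E}
    (hφ : φ ∈ IsManifold.maximalAtlas 𝓘(ℝ, E) 1 X) {C : ℝ}
    (hC : ∀ x ∈ φ.source, ∀ v : TangentSpace 𝓘(ℝ, E) x,
      N.norm x v ≤ C * Norm.norm (E := E) (mfderiv 𝓘(ℝ, E) 𝓘(ℝ, E) φ x v))
    {p₀ p₁ : E} {a b t : ℝ} (hab : a < b)
    (hp : ∀ t ∈ Icc a b, AffineMap.lineMap p₀ p₁ t ∈ φ.target) (ht : t ∈ Icc a b) :
    ContMDiffOn 𝓘(ℝ, ℝ) 𝓘(ℝ, E) 1 (fun t : ℝ => φ.symm (AffineMap.lineMap p₀ p₁ t)) (Icc a b) ∧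
    N.speedWithin (fun t : ℝ => φ.symm (AffineMap.lineMap p₀ p₁ t)) a b t ≤ C * ‖p₁ - p₀‖ := by
  have hline : ContDiff ℝ 1 (fun t : ℝ => (AffineMap.lineMap p₀ p₁ t : E)) := by
    simp only [AffineMap.lineMap_apply_module']
    fun_prop
  have hγ : ContMDiffOn 𝓘(ℝ, ℝ) 𝓘(ℝ, E) 1
      (fun t : ℝ => φ.symm (AffineMap.lineMap p₀ p₁ t)) (Icc a b) :=
    (contMDiffOn_symm_of_mem_maximalAtlas hφ).comp hline.contMDiff.contMDiffOn hp
  refine ⟨hγ, ?_⟩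
  set γ := fun t : ℝ => φ.symm (AffineMap.lineMap p₀ p₁ t) with hγdef
  have hu := (uniqueMDiffWithinAt_iff_uniqueDiffWithinAt).2 (uniqueDiffOn_Icc hab t ht)
  have hs : γ t ∈ φ.source := φ.map_target (hp t ht)
  rw [speedWithin_eq]
  refine (hC _ hs _).trans_eq ?_
  have h1 := mfderiv_comp_mfderivWithin t
    ((OpenPartialHomeomorph.mdifferentiable_of_mem_maximalAtlas hφ).mdifferentiableAt hs)
    (hγ.mdifferentiableOn one_ne_zero t ht) hu
  have h2 : EqOn (φ ∘ γ) (fun t : ℝ => (AffineMap.lineMap p₀ p₁ t : E)) (Icc a b) :=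
    fun r hr => φ.right_inv (hp r hr)
  rw [mfderivWithin_congr h2 (h2 ht)] at h1
  have h3 : mfderivWithin 𝓘(ℝ, ℝ) 𝓘(ℝ, E) (fun t : ℝ => (AffineMap.lineMap p₀ p₁ t : E))
      (Icc a b) t (1 : ℝ) = p₁ - p₀ := by
    rw [mfderivWithin_eq_fderivWithin]
    have : derivWithin (fun t : ℝ => (AffineMap.lineMap p₀ p₁ t : E)) (Icc a b) t = p₁ - p₀ :=
      AffineMap.hasDerivWithinAt_lineMap.derivWithin (uniqueDiffOn_Icc hab t ht)
    rw [← this, ← fderivWithin_derivWithin]; rfl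
  have h4 : mfderiv 𝓘(ℝ, E) 𝓘(ℝ, E) φ (γ t)
      (mfderivWithin 𝓘(ℝ, ℝ) 𝓘(ℝ, E) γ (Icc a b) t (1 : ℝ)) = p₁ - p₀ :=
    (congrArg (fun A : ℝ →L[ℝ] E => A 1) h1).symm.trans h3
  exact congrArg (fun e : E => C * ‖e‖) h4

variable {N} in
/-- In a complete Finsler manifold, a path on `[0, T)` that is Lipschitz for the Finsler distance
has a cluster point at `T`. -/
theorem IsComplete.exists_mapClusterPt [RegularSpace X] (hN : N.IsComplete) {T K : ℝ}
    (hT : 0 < T) {Γ : ℝ → X}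
    (hΓ : ∀ a b, 0 ≤ a → a < b → b < T →
      N.edist (Γ a) (Γ b) ≤ ENNReal.ofReal (K * (b - a))) :
    ∃ x, MapClusterPt x (𝓝[<] T) Γ := by
  obtain ⟨u, -, huT, hu⟩ := exists_seq_strictMono_tendsto' hT
  have hle : ∀ a ∈ Ioo 0 T, ∀ b ∈ Ioo 0 T,
      N.edist (Γ a) (Γ b) ≤ ENNReal.ofReal (K * |b - a|) := fun a ha b hb => by
    rcases lt_trichotomy a b with h | rfl | h
    · rw [abs_of_pos (sub_pos.2 h)]; exact hΓ a b ha.1.le h hb.2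
    · have : N.edist (Γ a) (Γ a) = 0 := by
        let := N.tangentENorm
        have := N.tangentENormSMulClass
        exact Manifold.riemannianEDist_self
      rw [this]; exact zero_le
    · rw [abs_sub_comm, abs_of_pos (sub_pos.2 h), N.edist_comm]; exact hΓ b a hb.1.le h ha.2
  obtain ⟨x, hx⟩ := hN (fun n => Γ (u n)) fun ε hε => by
    have hlim : Tendsto (fun mn : ℕ × ℕ => ENNReal.ofReal (K * |u mn.2 - u mn.1|))
        (atTop ×ˢ atTop) (𝓝 0) := by
      have h1 : Tendsto (fun mn : ℕ × ℕ => K * |u mn.2 - u mn.1|) (atTop ×ˢ atTop)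
          (𝓝 (K * |T - T|)) :=
        ((hu.comp tendsto_snd).sub (hu.comp tendsto_fst)).abs.const_mul K
      rw [sub_self, abs_zero, mul_zero] at h1
      simpa using ENNReal.tendsto_ofReal h1
    have hev := hlim.eventually (gt_mem_nhds hε)
    rw [prod_atTop_atTop_eq, eventually_atTop] at hev
    obtain ⟨⟨m₀, n₀⟩, h⟩ := hev
    refine ⟨max m₀ n₀, fun m hm n hn => (hle _ (huT m) _ (huT n)).trans_lt (h (m, n) ?_)⟩
    exact ⟨(le_max_left _ _).trans hm, (le_max_right _ _).trans hn⟩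
  refine ⟨x, MapClusterPt.of_comp (φ := u) (p := atTop) ?_ (Tendsto.mapClusterPt fun s hs => ?_)⟩
  · exact tendsto_nhdsWithin_iff.2 ⟨hu, Eventually.of_forall fun n => (huT n).2⟩
  · obtain ⟨ε, hε, h⟩ := N.exists_forall_edist_lt_mem hs
    refine mem_map.2 ?_
    filter_upwards [hx.eventually (gt_mem_nhds hε)] with n hn
    exact h _ (by rwa [N.edist_comm])

end FinslerStructure

variable [CompleteSpace E] [CompleteSpace F] [T2Space X] [RegularSpace X] [T2Space Y]
  {NX : FinslerStructure E X} {NY : FinslerStructure F Y} {f : X → Y}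

/-- Let `f` be a `C^1` map from a complete Finsler manifold with bijective differentials.  A `C^1`
path of bounded speed lifts from any point over its starting point, if the differentials of `f`
expand norms by a factor at least `α > 0` at all points over the path: lifts have bounded speed. -/
theorem exists_lift_of_speedWithin_le (hNX : NX.IsComplete)
    (hf : ContMDiff 𝓘(ℝ, E) 𝓘(ℝ, F) 1 f)
    (hbij : ∀ x, Function.Bijective (mfderiv 𝓘(ℝ, E) 𝓘(ℝ, F) f x)) {α K : ℝ} (hα : 0 < α)
    {γ : ℝ → Y} (hγ : ContMDiffOn 𝓘(ℝ, ℝ) 𝓘(ℝ, F) 1 γ (Icc 0 1))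
    (hK : ∀ a b, 0 ≤ a → a < b → b ≤ 1 → ∀ t ∈ Icc a b, NY.speedWithin γ a b t ≤ K)
    (hexp : ∀ x, f x ∈ γ '' Icc 0 1 → ∀ v, α * NX.norm x v ≤
      NY.norm (f x) (mfderiv 𝓘(ℝ, E) 𝓘(ℝ, F) f x v)) {x₀ : X} (h0 : f x₀ = γ 0) :
    ∃ Γ : ℝ → X, ContinuousOn Γ (Icc 0 1) ∧ Γ 0 = x₀ ∧ ∀ t ∈ Icc (0 : ℝ) 1, f (Γ t) = γ t := by
  have hloc := isLocalHomeomorph_of_bijective_mfderiv hf hbij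
  refine hloc.exists_lift_Icc hγ.continuousOn h0 fun T hT Γ hΓ hΓl => ?_
  refine hNX.exists_mapClusterPt (K := K / α) hT.1 fun a b ha hab hb => ?_
  have hsub : Icc a b ⊆ Ico 0 T := fun t ht => ⟨ha.trans ht.1, ht.2.trans_lt hb⟩
  have hsub' : Icc a b ⊆ Icc 0 1 := fun t ht => ⟨ha.trans ht.1, ht.2.trans (hb.le.trans hT.2)⟩
  have hl : EqOn (f ∘ Γ) γ (Icc a b) := fun t ht => hΓl t (hsub ht)
  have hΓ1 : ContMDiffOn 𝓘(ℝ, ℝ) 𝓘(ℝ, E) 1 Γ (Icc a b) :=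
    hloc.contMDiffOn_lift one_ne_zero hf hbij (hγ.mono hsub') (hΓ.mono hsub) hl
  refine NX.edist_le_of_norm_le hab.le hΓ1 fun t ht => ?_
  rw [← NX.speedWithin_eq, le_div_iff₀' hα]
  calc α * NX.speedWithin Γ a b t
      ≤ NY.speedWithin (f ∘ Γ) a b t :=
        FinslerStructure.mul_speedWithin_le hf hab hΓ1 ht
          (hexp _ ⟨t, hsub' ht, (hl ht).symm⟩)
    _ = NY.speedWithin γ a b t := FinslerStructure.speedWithin_congr hl ht
    _ ≤ K := hK a b ha hab (hb.le.trans hT.2) t ht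

end Segments

/-! ### Smooth covering maps -/

section Covering

open Set unitInterval

variable {E : Type*} [NormedAddCommGroup E] [NormedSpace ℝ E] [CompleteSpace E]
  {X : Type*} [TopologicalSpace X] [ChartedSpace E X]
  {F : Type*} [NormedAddCommGroup F] [NormedSpace ℝ F] [CompleteSpace F]
  {Y : Type*} [TopologicalSpace Y] [ChartedSpace F Y] {f : X → Y}

/-- The image of a continuous section over an open set `V` is an open set that `f` maps
diffeomorphically onto `V`. -/
theorem isOpen_and_mapsDiffeomorphically_range {k : ℕ∞} (hk : k ≠ 0)
    (hf : ContMDiff 𝓘(ℝ, E) 𝓘(ℝ, F) k f) (hloc : IsLocalHomeomorph f)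
    (hbij : ∀ x, Function.Bijective (mfderiv 𝓘(ℝ, E) 𝓘(ℝ, F) f x)) [Nonempty X] {V : Set Y}
    (hV : IsOpen V) {s : V → X} (hs : Continuous s) (hfs : ∀ v, f (s v) = v) :
    IsOpen (range s) ∧ MapsDiffeomorphically E F k f (range s) V := by
  classical
  have hk' : (k : WithTop ℕ∞) ≠ 0 := by exact_mod_cast hk
  have hcomp : f ∘ s = Subtype.val := funext hfs
  have hopen : IsOpen (range s) :=
    (hloc.isOpenEmbedding_of_comp (hcomp ▸ hV.isOpenEmbedding_subtypeVal) hs).isOpen_range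
  let g : Y → X := fun y => if h : y ∈ V then s ⟨y, h⟩ else Classical.arbitrary X
  have hg : ∀ v : V, g v = s v := fun v => dif_pos v.2
  have hgc : ContinuousOn g V := by
    rw [continuousOn_iff_continuous_domRestrict]
    exact hs.congr fun v => (hg v).symm
  have hinv : InvOn g f (range s) V := by
    constructor
    · rintro _ ⟨v, rfl⟩
      rw [hfs, hg]
    · intro y hy
      exact (congrArg f (hg ⟨y, hy⟩)).trans (hfs _)
  have hmaps : MapsTo f (range s) V := by
    rintro _ ⟨v, rfl⟩
    rw [hfs]; exact v.2
  have hmaps' : MapsTo g V (range s) := fun y hy => ⟨⟨y, hy⟩, (hg ⟨y, hy⟩).symm⟩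
  exact ⟨hopen, hinv.bijOn hmaps hmaps', hf.contMDiffOn, g, hmaps', hinv,
    hloc.contMDiffOn_lift hk' hf hbij contMDiffOn_id hgc hinv.2⟩

/-- A criterion for smooth covering maps to a connected manifold: every point of the target has an
open neighbourhood `V` whose preimage is swept out by continuous sections over `V` with
pairwise disjoint images. -/
theorem isSmoothCoveringMap_of_exists_sections {k : ℕ∞} (hk : k ≠ 0)
    (hf : ContMDiff 𝓘(ℝ, E) 𝓘(ℝ, F) k f) (hloc : IsLocalHomeomorph f)
    (hbij : ∀ x, Function.Bijective (mfderiv 𝓘(ℝ, E) 𝓘(ℝ, F) f x)) [Nonempty X]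
    [ConnectedSpace Y]
    (hsec : ∀ y : Y, ∃ (V : Set Y) (ι : Type _) (s : ι → V → X), IsOpen V ∧ y ∈ V ∧
      (∀ e, Continuous (s e)) ∧ (∀ e v, f (s e v) = v) ∧
      (∀ e e' v, s e v = s e' v → e = e') ∧ ∀ x (h : f x ∈ V), ∃ e, s e ⟨f x, h⟩ = x) :
    IsSmoothCoveringMap E F k f := by
  constructor
  · -- The range of `f` is open, and closed because each `V` is contained in or disjoint from it.
    have hclosed : IsClosed (range f) := by
      refine isClosed_of_closure_subset fun y hy => ?_
      obtain ⟨V, ι, s, hV, hyV, -, hfs, -, hcov⟩ := hsec y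
      obtain ⟨_, hxV, x, rfl⟩ := mem_closure_iff.1 hy V hV hyV
      obtain ⟨e, -⟩ := hcov x hxV
      exact ⟨s e ⟨y, hyV⟩, hfs _ _⟩
    exact range_eq_univ.1 <|
      IsClopen.eq_univ ⟨hclosed, hloc.isOpenMap.isOpen_range⟩ (range_nonempty f)
  · intro y
    obtain ⟨V, ι, s, hV, hyV, hsc, hfs, hinj, hcov⟩ := hsec y
    have H := fun e => isOpen_and_mapsDiffeomorphically_range hk hf hloc hbij hV (hsc e) (hfs e)
    refine ⟨V, hV, hyV, range fun e => range (s e), ?_, ?_, ?_, ?_⟩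
    · rintro _ ⟨e, rfl⟩
      exact (H e).1
    · rintro _ ⟨e, rfl⟩ _ ⟨e', rfl⟩ hne
      refine disjoint_left.2 ?_
      rintro _ ⟨v, rfl⟩ ⟨v', hv'⟩
      have hvv : v' = v := Subtype.ext (by rw [← hfs e v, ← hfs e' v', hv'])
      subst hvv
      exact hne (by rw [hinj _ _ _ hv'])
    · ext x
      rw [sUnion_range, mem_iUnion, mem_preimage]
      constructor
      · intro h
        obtain ⟨e, he⟩ := hcov x h
        exact ⟨e, _, he⟩
      · rintro ⟨e, v, rfl⟩
        rw [hfs]; exact v.2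
    · rintro _ ⟨e, rfl⟩
      exact (H e).2

variable [IsManifold 𝓘(ℝ, E) 1 X] [IsManifold 𝓘(ℝ, F) 1 Y]
  {NX : FinslerStructure E X} {NY : FinslerStructure F Y}

/-- At a point where one of the indicators is at least `α`, the differential of a Fredholm map of
index zero is bijective and expands norms by at least `α`. -/
theorem IsFredholmMapOfIndexZero.bijective_mfderiv_and_le {k : ℕ∞}
    (hf : IsFredholmMapOfIndexZero E F k f) {x : X} {α : ℝ} (hα : 0 < α)
    (h : ENNReal.ofReal α ≤ injIndicator NX NY x (f x) (mfderiv 𝓘(ℝ, E) 𝓘(ℝ, F) f x) ∨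
      ENNReal.ofReal α ≤ surIndicator NX NY x (f x) (mfderiv 𝓘(ℝ, E) 𝓘(ℝ, F) f x)) :
    Function.Bijective (mfderiv 𝓘(ℝ, E) 𝓘(ℝ, F) f x) ∧
      ∀ v, α * NX.norm x v ≤ NY.norm (f x) (mfderiv 𝓘(ℝ, E) 𝓘(ℝ, F) f x v) :=
  bijective_and_le_map_of_le_indicator (E := E) (F := F) (NX.isEquivalentNorm_norm x)
    (NY.isEquivalentNorm_norm (f x)) (mfderiv 𝓘(ℝ, E) 𝓘(ℝ, F) f x) (hf.isFredholm x)
    (hf.index_eq_zero x) hα h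

variable [T2Space X] [RegularSpace X] [T2Space Y]

/-- If `df` is bijective everywhere and expands norms by at least `α > 0` over a neighbourhood of
`y`, then `y` has a neighbourhood, the preimage of a ball in a chart, over which `f` has a
continuous section through each point of the fibre of `y`, and these sections sweep out the
preimage.  They are obtained by lifting the radii of the ball. -/
theorem exists_sections_of_le_mfderiv (hNX : NX.IsComplete)
    (hf : ContMDiff 𝓘(ℝ, E) 𝓘(ℝ, F) 1 f)
    (hbij : ∀ x, Function.Bijective (mfderiv 𝓘(ℝ, E) 𝓘(ℝ, F) f x)) {y : Y} {α : ℝ} (hα : 0 < α)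
    {W : Set Y} (hW : W ∈ 𝓝 y)
    (hexp : ∀ x, f x ∈ W → ∀ v, α * NX.norm x v ≤
      NY.norm (f x) (mfderiv 𝓘(ℝ, E) 𝓘(ℝ, F) f x v)) :
    ∃ (V : Set Y) (s : f ⁻¹' {y} → V → X), IsOpen V ∧ y ∈ V ∧
      (∀ e, Continuous (s e)) ∧ (∀ e v, f (s e v) = v) ∧
      (∀ e e' v, s e v = s e' v → e = e') ∧ ∀ x (h : f x ∈ V), ∃ e, s e ⟨f x, h⟩ = x := by
  have hloc := isLocalHomeomorph_of_bijective_mfderiv hf hbij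
  obtain ⟨φ, hφ, hyφ, c, C, -, -, hC⟩ := NY.exists_chart_equivalent y
  have hB : φ.target ∩ φ.symm ⁻¹' W ∈ 𝓝 (φ y) :=
    Filter.inter_mem (φ.open_target.mem_nhds (φ.map_source hyφ))
      ((φ.continuousAt_symm (φ.map_source hyφ)).preimage_mem_nhds (by rwa [φ.left_inv hyφ]))
  obtain ⟨r, hr, hball⟩ := Metric.mem_nhds_iff.1 hB
  have hmem : ∀ p₀ ∈ Metric.ball (φ y) r, ∀ p₁ ∈ Metric.ball (φ y) r, ∀ t ∈ Icc (0 : ℝ) 1,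
      (AffineMap.lineMap p₀ p₁ t : F) ∈ Metric.ball (φ y) r := fun p₀ h₀ p₁ h₁ t ht =>
    (convex_ball (φ y) r).lineMap_mem h₀ h₁ ht
  -- Segments in the ball lift from any point over their starting point, so radii can be lifted
  -- outwards from a point of the fibre over `y`, and inwards to find the section through a point.
  have hlift : ∀ p₀ ∈ Metric.ball (φ y) r, ∀ p₁ ∈ Metric.ball (φ y) r, ∀ x, f x = φ.symm p₀ →
      ∃ Γ : ℝ → X, ContinuousOn Γ (Icc 0 1) ∧ Γ 0 = x ∧
        ∀ t ∈ Icc (0 : ℝ) 1, f (Γ t) = φ.symm (AffineMap.lineMap p₀ p₁ t) := by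
    intro p₀ h₀ p₁ h₁ x hx
    have hseg := fun a b (ha : 0 ≤ a) (hab : a < b) (hb : b ≤ 1) t (ht : t ∈ Icc a b) =>
      FinslerStructure.speedWithin_segment_le hφ (fun x hx v => (hC x hx v).2) hab
        (fun t ht => (hball (hmem p₀ h₀ p₁ h₁ t ⟨ha.trans ht.1, ht.2.trans hb⟩)).1) ht
    refine exists_lift_of_speedWithin_le (NY := NY) (K := C * ‖p₁ - p₀‖) hNX hf hbij hα
      (hseg 0 1 le_rfl one_pos le_rfl 0 (left_mem_Icc.2 zero_le_one)).1
      (fun a b ha hab hb t ht => (hseg a b ha hab hb t ht).2) ?_ (by simpa using hx)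
    rintro x' ⟨t, ht, hx'⟩
    refine hexp x' ?_
    rw [← hx']
    exact (hball (hmem p₀ h₀ p₁ h₁ t ht)).2
  let V : Set Y := φ.source ∩ φ ⁻¹' Metric.ball (φ y) r
  have hV : IsOpen V := φ.isOpen_inter_preimage Metric.isOpen_ball
  have hcy : φ y ∈ Metric.ball (φ y) r := Metric.mem_ball_self hr
  let H : C(I × V, Y) := ⟨fun tv => φ.symm (AffineMap.lineMap (φ y) (φ tv.2) (tv.1 : ℝ)), by
    refine φ.continuousOn_symm.comp_continuous ?_ fun tv =>
      (hball (hmem _ hcy _ tv.2.2.2 _ tv.1.2)).1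
    have hφc : Continuous fun tv : I × V => φ tv.2 :=
      φ.continuousOn.comp_continuous (continuous_subtype_val.comp continuous_snd)
        fun tv => tv.2.2.1
    simp only [AffineMap.lineMap_apply_module']
    exact ((continuous_subtype_val.comp continuous_fst).smul
      (hφc.sub continuous_const)).add continuous_const⟩
  have hH : ∀ t v, H (t, v) = φ.symm (AffineMap.lineMap (φ y) (φ v) (t : ℝ)) := fun _ _ => rfl
  obtain ⟨s, hs⟩ := hloc.exists_sections (c := y) H
    (fun v => by rw [hH]; simp [hyφ]) (fun v => by rw [hH]; simp [v.2.1])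
    (fun x hx v => by
      obtain ⟨Γ, hΓ, hΓ0, hΓl⟩ := hlift _ hcy _ v.2.2 x (by rw [hx, φ.left_inv hyφ])
      exact ⟨⟨fun t => Γ t, hΓ.comp_continuous continuous_subtype_val fun t => t.2⟩, hΓ0,
        fun t => hΓl t t.2⟩)
    (fun x v hx => by
      obtain ⟨Γ, hΓ, hΓ0, hΓl⟩ := hlift _ v.2.2 _ hcy x (by rw [hx, φ.left_inv v.2.1])
      refine ⟨⟨fun t => Γ (σ t), hΓ.comp_continuous (by fun_prop) fun t => (σ t).2⟩,
        by simpa using hΓ0, fun t => ?_⟩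
      rw [hH, ContinuousMap.coe_mk, hΓl _ (σ t).2, coe_symm_eq,
        AffineMap.lineMap_apply_one_sub])
  exact ⟨V, s, hV, ⟨hyφ, hcy⟩, hs⟩

end Covering

end

theorem mainTheorem2
    {E : Type*} [NormedAddCommGroup E] [NormedSpace ℝ E] [CompleteSpace E]
    {F : Type*} [NormedAddCommGroup F] [NormedSpace ℝ F] [CompleteSpace F]
    (k : ℕ∞) (hk : 1 ≤ k)
    {X : Type*} [TopologicalSpace X] [T2Space X] [ParacompactSpace X] [Nonempty X]
    [ChartedSpace E X] [IsManifold 𝓘(ℝ, E) 1 X] [IsManifold 𝓘(ℝ, E) k X]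
    {Y : Type*} [TopologicalSpace Y] [T2Space Y] [ParacompactSpace Y] [ConnectedSpace Y]
    [ChartedSpace F Y] [IsManifold 𝓘(ℝ, F) 1 Y] [IsManifold 𝓘(ℝ, F) k Y]
    (NX : FinslerStructure E X) (NY : FinslerStructure F Y)
    (f : X → Y) (hf : IsFredholmMapOfIndexZero E F k f)
    (hEE : EarleEellsCondition NX NY f) :
    IsSmoothCoveringMap E F k f := by
  obtain ⟨hNX, hEE⟩ := hEE
  have hf1 : ContMDiff 𝓘(ℝ, E) 𝓘(ℝ, F) 1 f := hf.contMDiff.of_le (by exact_mod_cast hk)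
  have hbij : ∀ x, Function.Bijective (mfderiv 𝓘(ℝ, E) 𝓘(ℝ, F) f x) := fun x => by
    obtain ⟨α, hα, V, hV, h⟩ := hEE (f x)
    exact (hf.bijective_mfderiv_and_le hα (h x (mem_of_mem_nhds hV :))).1
  refine isSmoothCoveringMap_of_exists_sections (Order.one_le_iff_pos.1 hk).ne' hf.contMDiff
    (isLocalHomeomorph_of_bijective_mfderiv hf1 hbij) hbij fun y => ?_
  obtain ⟨α, hα, W, hW, h⟩ := hEE y
  obtain ⟨V, s, hs⟩ := exists_sections_of_le_mfderiv (NY := NY) hNX hf1 hbij hα hW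
    fun x hx => (hf.bijective_mfderiv_and_le hα (h x hx)).2
  exact ⟨V, _, s, hs⟩
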